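/- Let $d\ge 0$ and let $\gamma,\nu$ be $\sigma$-finite Borel measures on $\mathbb{R}^d$ (for instance locally finite ones). Consider the branching (cluster) process on $\mathbb{R}^d$ in which every individual, independently of all the others, has as offspring a Poisson random sample of intensity $\gamma$ centered at its own position; the process starts from a single individual. Let $\xi$ denote the family of positions, relative to the initial point, of all the descendants (of all generations, initial point excluded, counted with multiplicity). For measurable $f:\mathbb{R}^d\to\mathbb{R}$ and $z\in\mathbb{R}^d$, the probability generating functional (PGFl) of the cluster started from $z$ is $$G_z(f)=f(z)\,\mathbb{E}\Big[\prod_{x\in\xi}f(z+x)\Big].$$ The Hawkes process with immigrant intensity $\nu$ is the superposition of the clusters (initial points included) started from the points of a Poisson sample of intensity $\nu$, the branchings being independent of each other and of this sample; its PGFl $G_\nu(f)$ is the expectation of the product of the values of $f$ at all its points. Say that $f$ is *admissible at $z$* if almost surely $\sum_{x\in\xi}|f(z+x)-1|<\infty$ and $\prod_{x\in\xi}f(z+x)$ is integrable, and *admissible for the Hawkes process* if almost surely $\sum|f-1|<\infty$ over all its points and the product of $f$ over its points is integrable. Let $f:\mathbb{R}^d\to\mathbb{R}$ be measurable. 1.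 If $f$ is admissible at $z$, then $f$ is admissible at $z+x$ for $\gamma$-almost every $x$ such that $f(z+x)\neq 0$, the function $x\mapsto G_{z+x}(f)-1$ is $\gamma$-integrable, and $$G_z(f)=f(z)\exp\Big(\int_{\mathbb{R}^d}(G_{z+x}(f)-1)\,\gamma(dx)\Big).$$ 2. If $f$ is admissible for the Hawkes process, then $f$ is admissible at $\nu$-almost every $z$ such that $f(z)\ne 0$, the function $z\mapsto G_z(f)-1$ is $\nu$-integrable, and $$G_\nu(f)=\exp\Big(\int_{\mathbb{R}^d}(G_z(f)-1)\,\nu(dz)\Big).$$ 3. If $0\le f\le 1$, then both identities hold (the first one for all $z\in\mathbb{R}^d$) without any admissibility assumption, where the integrals of $G_{z+x}(f)-1\le 0$ and $G_z(f)-1\le 0$ may be $-\infty$ and $\exp(-\infty)=0$. -/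

import Mathlib

open MeasureTheory ProbabilityTheory
open scoped ENNReal NNReal

namespace HawkesCluster

noncomputable section

/-- The Euclidean space `ℝ^d`. -/
abbrev Space (d : ℕ) : Type := EuclideanSpace ℝ (Fin d)

/-! ### Poisson random samples

A σ-finite intensity `m` is written as a countable sum of finite measures `m_k`. A Poisson sample
of intensity `m` is the superposition over `k` of independent Poisson samples of intensity `m_k`,
and a Poisson sample of finite intensity `m_k` consists of a Poisson distributed number (of mean the
total mass of `m_k`) of independent points with law `m_k` normalized. The points are kept as a
family indexed by pairs `(k, j)` (`j`-th point of the `k`-th piece), so that multiplicities are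
taken into account when the intensity has atoms. -/

/-- Indices of the possible points of a sample: `(k, j)` is the `j`-th point of the piece `k`. -/
abbrev Idx : Type := ℕ × ℕ

/-- Outcomes of a sampling: for each piece `k`, the number of points `(s k).1`, and a sequence
`(s k).2` of locations, of which only the first `(s k).1` are points of the sample. -/
abbrev Sample (d : ℕ) : Type := ℕ → ℕ × (ℕ → Space d)

/-- `c` is (the index of) a point of the sample `s`. -/
def Sample.Present {d : ℕ} (s : Sample d) (c : Idx) : Prop := c.2 < (s c.1).1

/-- The location of the point of index `c` of the sample `s`. -/
def Sample.loc {d : ℕ} (s : Sample d) (c : Idx) : Space d := (s c.1).2 c.2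

/-- The law of a Poisson sample of finite intensity `m`: a Poisson number of points, of mean
`m(ℝ^d)`, and i.i.d. locations distributed as `m / m(ℝ^d)`. (If `m = 0` there is almost surely no
point, and the law of the unused locations is irrelevant.) -/
def finitePoissonLaw {d : ℕ} (m : Measure (Space d)) [IsFiniteMeasure m] :
    Measure (ℕ × (ℕ → Space d)) :=
  (poissonMeasure (m Set.univ).toNNReal).prod
    (Measure.infinitePi fun _ : ℕ =>
      ((FiniteMeasure.normalize ⟨m, inferInstance⟩ : ProbabilityMeasure (Space d)) :
        Measure (Space d)))

instance {d : ℕ} (m : Measure (Space d)) [IsFiniteMeasure m] :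
    IsProbabilityMeasure (finitePoissonLaw m) := by
  unfold finitePoissonLaw; infer_instance

/-- The law of a Poisson sample of σ-finite intensity `m`, by superposition of independent Poisson
samples of intensities `m_k`, where `m = ∑ m_k` with finite `m_k`. -/
def poissonLaw {d : ℕ} (m : Measure (Space d)) [SFinite m] : Measure (Sample d) :=
  Measure.infinitePi fun k : ℕ => finitePoissonLaw (sfiniteSeq m k)

instance {d : ℕ} (m : Measure (Space d)) [SFinite m] : IsProbabilityMeasure (poissonLaw m) := by
  unfold poissonLaw; infer_instance

/-! ### The branching cluster of a single point -/

/-- Potential individuals of the branching process: `[]` is the initial point, and `[c₁, …, cₙ]` is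
the `cₙ`-th child of the … of the `c₁`-th child of the initial point. -/
abbrev Label : Type := List Idx

/-- Outcomes of the branching: to each potential individual is attached a sample, which gives its
offspring, positioned relatively to it. -/
abbrev Env (d : ℕ) : Type := Label → Sample d

/-- The law of the branching: independent Poisson samples of intensity `γ`, one per individual. -/
def branchingLaw {d : ℕ} (γ : Measure (Space d)) [SFinite γ] : Measure (Env d) :=
  Measure.infinitePi fun _ : Label => poissonLaw γ

instance {d : ℕ} (γ : Measure (Space d)) [SFinite γ] : IsProbabilityMeasure (branchingLaw γ) := by
  unfold branchingLaw; infer_instance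

/-- The potential individual `u` is an actual individual of the cluster. -/
def Alive {d : ℕ} : Env d → Label → Prop
  | _, [] => True
  | ω, c :: u => (ω []).Present c ∧ Alive (fun v => ω (c :: v)) u

/-- The position of an individual relative to the initial point: the sum of the displacements
along its ancestral line. -/
def position {d : ℕ} : Env d → Label → Space d
  | _, [] => 0
  | ω, c :: u => (ω []).loc c + position (fun v => ω (c :: v)) u

/-- The individuals of the cluster other than the initial point. The points of the cluster `ξ`
started from `0`, without the initial point, are the `position ω u`, `u ∈ descendants ω`. -/
def descendants {d : ℕ} (ω : Env d) : Set Label := {u | u ≠ [] ∧ Alive ω u}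

/-- `∏_{x ∈ ξ} f(z + x)`, where `ξ` is the set of descendants of the initial point `0`. -/
def clusterProd {d : ℕ} (f : Space d → ℝ) (z : Space d) (ω : Env d) : ℝ :=
  ∏' u : descendants ω, f (z + position ω u)

/-- The probability generating functional of the cluster started from a single point at `z`,
`G_z(f) = f(z) E[∏_{x ∈ ξ} f(z + x)]`. -/
def clusterPGFl {d : ℕ} (γ : Measure (Space d)) [SFinite γ] (f : Space d → ℝ) (z : Space d) : ℝ :=
  f z * ∫ ω, clusterProd f z ω ∂(branchingLaw γ)

/-- `f` is sufficiently integrable for `G_z(f)` to be defined: the product over the cluster is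
almost surely absolutely convergent, and has a finite expectation. -/
structure ClusterAdmissible {d : ℕ} (γ : Measure (Space d)) [SFinite γ] (f : Space d → ℝ)
    (z : Space d) : Prop where
  summable : ∀ᵐ ω ∂(branchingLaw γ),
    Summable fun u : descendants ω => |f (z + position ω u) - 1|
  integrable : Integrable (clusterProd f z) (branchingLaw γ)

/-! ### The Hawkes process -/

/-- Outcomes of the Hawkes process: the sample of immigrants, and a branching for each of them. -/
abbrev HawkesEnv (d : ℕ) : Type := Sample d × (Idx → Env d)

/-- The law of the Hawkes process: the immigrants form a Poisson sample of intensity `ν`, and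
independently of it, independent branchings with offspring intensity `γ` are attached to them. -/
def hawkesLaw {d : ℕ} (ν γ : Measure (Space d)) [SFinite ν] [SFinite γ] : Measure (HawkesEnv d) :=
  (poissonLaw ν).prod (Measure.infinitePi fun _ : Idx => branchingLaw γ)

instance {d : ℕ} (ν γ : Measure (Space d)) [SFinite ν] [SFinite γ] :
    IsProbabilityMeasure (hawkesLaw ν γ) := by
  unfold hawkesLaw; infer_instance

/-- The individuals of the Hawkes process: pairs of an immigrant `i` and of an individual `u` of
the cluster started by `i` (the immigrant itself is `u = []`). -/
def hawkesPoints {d : ℕ} (η : HawkesEnv d) : Set (Idx × Label) :=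
  {p | η.1.Present p.1 ∧ Alive (η.2 p.1) p.2}

/-- The position of an individual of the Hawkes process. -/
def hawkesPosition {d : ℕ} (η : HawkesEnv d) (p : Idx × Label) : Space d :=
  η.1.loc p.1 + position (η.2 p.1) p.2

/-- The product of the values of `f` at the points of the Hawkes process. -/
def hawkesProd {d : ℕ} (f : Space d → ℝ) (η : HawkesEnv d) : ℝ :=
  ∏' p : hawkesPoints η, f (hawkesPosition η p)

/-- The probability generating functional `G_ν(f)` of the Hawkes process with immigrant intensity
`ν` and offspring intensity `γ`: the expectation of the product of `f` over all its points. -/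
def hawkesPGFl {d : ℕ} (ν γ : Measure (Space d)) [SFinite ν] [SFinite γ] (f : Space d → ℝ) : ℝ :=
  ∫ η, hawkesProd f η ∂(hawkesLaw ν γ)

/-- `f` is sufficiently integrable for `G_ν(f)` to be defined: the product over the Hawkes process
is almost surely absolutely convergent, and has a finite expectation. -/
structure HawkesAdmissible {d : ℕ} (ν γ : Measure (Space d)) [SFinite ν] [SFinite γ]
    (f : Space d → ℝ) : Prop where
  summable : ∀ᵐ η ∂(hawkesLaw ν γ),
    Summable fun p : hawkesPoints η => |f (hawkesPosition η p) - 1|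
  integrable : Integrable (hawkesProd f) (hawkesLaw ν γ)

end

end HawkesCluster

namespace HawkesCluster

open Filter Topology

/-! ### Products of independent coordinates -/

/-! A Hawkes process is a Poisson sample of immigrants carrying independent branchings as marks.
Grouping its points by immigrant turns the product of `f` into the product over immigrants of `h (z,
ω) = f z * clusterProd f z ω`. For a Poisson sample of intensity `ν` with independent marks of law
`P`, the exponential formula reads `E ∏ h = exp ∫ (h - 1) d(ν ⊗ P)`; integrating out the mark first
turns `h - 1` into `G_z(f) - 1`.

The cluster identity is the same statement with `ν = γ`: the descendants of a point at `z` form a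
Hawkes process whose immigrants are its children, evaluated on the translate `y ↦ f (z + y)`
(`map_joinRoot`, `clusterProd_eq_hawkesProd`).

The exponential formula holds by independence for finitely many finite pieces of `ν`
(`integral_partialProd`), and passes to the limit by domination, either when `0 ≤ h ≤ 1`
(`ofReal_integral_of_mem_Icc`) or when `h - 1` is integrable (`integral_of_integrable_sub_one`). The
remaining difficulty is to deduce integrability of `h - 1` from almost sure absolute convergence and
a finite expectation (`integrable_sub_one_of_integrable`): the formula for `exp (-|h - 1|)` controls
`min |h - 1| 1`, and the formula for truncations of `|h|` controls the large values. -/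

theorem integral_prod_infinitePi {ι : Type*} {X : ι → Type*} [∀ i, MeasurableSpace (X i)]
    (μ : ∀ i, Measure (X i)) [∀ i, IsProbabilityMeasure (μ i)] (I : Finset ι)
    {φ : ∀ i, X i → ℝ} (hφ : ∀ i, Measurable (φ i)) :
    ∫ ω, ∏ i ∈ I, φ i (ω i) ∂Measure.infinitePi μ = ∏ i ∈ I, ∫ x, φ i x ∂μ i := by
  have h := integral_restrict_infinitePi (μ := μ) (s := I)
    (f := fun y : (∀ i : I, X i) => ∏ i : I, φ i (y i))
    (Measurable.aestronglyMeasurable (by fun_prop))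
  simp only [Finset.restrict] at h
  rw [integral_fintype_prod_eq_prod (f := fun i : I => φ i)] at h
  rw [Finset.prod_coe_sort I (fun i => ∫ x, φ i x ∂μ i)] at h
  rw [← h]
  congr 1 with ω
  exact (Finset.prod_coe_sort I (fun i => φ i (ω i))).symm

theorem lintegral_prod_infinitePi {ι : Type*} {X : ι → Type*} [∀ i, MeasurableSpace (X i)]
    (μ : ∀ i, Measure (X i)) [∀ i, IsProbabilityMeasure (μ i)] (I : Finset ι)
    {φ : ∀ i, X i → ℝ≥0∞} (hφ : ∀ i, Measurable (φ i)) :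
    ∫⁻ ω, ∏ i ∈ I, φ i (ω i) ∂Measure.infinitePi μ = ∏ i ∈ I, ∫⁻ x, φ i x ∂μ i := by
  refine (lintegral_prod_eq_prod_lintegral_of_indepFun I
    (fun i (ω : ∀ i, X i) => φ i (ω i))
    (iIndepFun_infinitePi hφ) (fun i => (hφ i).comp (measurable_pi_apply i))).trans ?_
  refine Finset.prod_congr rfl fun i _ => ?_
  exact (measurePreserving_eval_infinitePi μ i).lintegral_comp (hφ i)

theorem enorm_finset_prod {ι : Type*} (s : Finset ι) (f : ι → ℝ) :
    ‖∏ i ∈ s, f i‖ₑ = ∏ i ∈ s, ‖f i‖ₑ := by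
  induction s using Finset.cons_induction with
  | empty => simp
  | cons a s ha ih => rw [Finset.prod_cons, Finset.prod_cons, enorm_mul, ih]

/-! ### The generating function of the Poisson distribution -/

theorem integral_pow_poissonMeasure (r : ℝ≥0) (a : ℝ) :
    ∫ n, a ^ n ∂poissonMeasure r = Real.exp (r * (a - 1)) := by
  rw [integral_poissonMeasure]
  have h := (NormedSpace.expSeries_div_hasSum_exp (r * a : ℝ)).mul_left (Real.exp (-r))
  rw [← Real.exp_eq_exp_ℝ, ← Real.exp_add] at h
  rw [show (r : ℝ) * (a - 1) = -r + r * a by ring, ← h.tsum_eq]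
  congr 1 with n
  simp only [smul_eq_mul, mul_pow]
  ring

/-- The case `r = 0` serves the pieces of zero mass: their normalized law is an arbitrary default,
against which the function at hand may fail to be integrable, but there are almost surely no points.
-/
theorem lintegral_pow_poissonMeasure_lt_top {r : ℝ≥0} {a : ℝ≥0∞} (h : r = 0 ∨ a ≠ ∞) :
    ∫⁻ n, a ^ n ∂poissonMeasure r < ∞ := by
  rcases h with rfl | h
  · have : poissonMeasure 0 = Measure.dirac 0 := by
      refine Measure.ext_of_singleton fun n => ?_
      rw [poissonMeasure_singleton]
      rcases n with _ | n <;> simp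
    simp [this]
  · lift a to ℝ≥0 using h
    have hi : Integrable (fun n : ℕ => (a : ℝ) ^ n) (poissonMeasure r) := by
      rw [integrable_poissonMeasure_iff]
      refine ((NormedSpace.expSeries_div_hasSum_exp (r * a : ℝ)).mul_left
        (Real.exp (-r))).summable.congr fun n => ?_
      simp only [norm_pow, Real.norm_eq_abs, NNReal.abs_eq, mul_pow]
      ring
    refine lt_of_le_of_lt (le_of_eq ?_) hi.2
    congr 1 with n
    simp [enorm_pow]

theorem measurable_nat_comp {α β : Type*} [MeasurableSpace α] [MeasurableSpace β] {N : α → ℕ}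
    (hN : Measurable N) {F : ℕ → α → β} (hF : ∀ n, Measurable (F n)) :
    Measurable fun a => F (N a) a := by
  have h : Measurable (fun q : ℕ × α => F q.1 q.2) := measurable_from_prod_countable_right hF
  exact h.comp (hN.prodMk measurable_id)

/-! ### Partial products over a marked sample -/

section Marked

variable {d : ℕ} {E : Type*}

/-- The product of `g` over the marked points in the first `n` pieces of a sample. -/
def partialProd {R : Type*} [CommMonoid R] (g : Space d × E → R) (n : ℕ)
    (p : Sample d × (Idx → E)) : R :=
  ∏ k ∈ Finset.range n, ∏ j ∈ Finset.range (p.1 k).1, g ((p.1 k).2 j, p.2 (k, j))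

variable [MeasurableSpace E]

theorem measurable_partialProd {R : Type*} [CommMonoid R] [MeasurableSpace R] [MeasurableMul₂ R]
    {g : Space d × E → R} (hg : Measurable g) (n : ℕ) : Measurable (partialProd g n) := by
  unfold partialProd
  refine Finset.measurable_prod _ fun k _ => ?_
  refine measurable_nat_comp (F := fun N (p : Sample d × (Idx → E)) =>
    ∏ j ∈ Finset.range N, g ((p.1 k).2 j, p.2 (k, j))) (by fun_prop) fun N => ?_
  refine Finset.measurable_prod _ fun j _ => hg.comp ?_
  fun_prop

/-- Rewrites the double product over pieces and points as one product over a finite set of indices,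
to which independence of the marks applies. -/
theorem exists_finset_pairs (s : Sample d) (n : ℕ) :
    ∃ I : Finset (ℕ × ℕ), ∀ p, p ∈ I ↔ p.1 ∈ Finset.range n ∧ p.2 ∈ Finset.range (s p.1).1 :=
  ⟨(Finset.range n).biUnion fun k => (Finset.range (s k).1).image fun j => (k, j), by
    rintro ⟨k, j⟩; simp⟩

theorem integral_partialProd_marks (P : Measure E) [IsProbabilityMeasure P]
    {g : Space d × E → ℝ} (hg : Measurable g) (n : ℕ) (s : Sample d) :
    ∫ η, partialProd g n (s, η) ∂Measure.infinitePi (fun _ : Idx => P) =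
      ∏ k ∈ Finset.range n, ∏ j ∈ Finset.range (s k).1, ∫ e, g ((s k).2 j, e) ∂P := by
  obtain ⟨I, hI⟩ := exists_finset_pairs s n
  have h := integral_prod_infinitePi (fun _ : Idx => P) I
    (φ := fun i e => g (s.loc i, e)) (fun i => by fun_prop)
  rw [Finset.prod_finset_product I _ (fun k => Finset.range (s k).1) hI] at h
  simp only [Sample.loc] at h
  rw [← h]
  congr 1 with η
  rw [Finset.prod_finset_product I _ (fun k => Finset.range (s k).1) hI]
  rfl

theorem lintegral_partialProd_marks (P : Measure E) [IsProbabilityMeasure P]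
    {g : Space d × E → ℝ≥0∞} (hg : Measurable g) (n : ℕ) (s : Sample d) :
    ∫⁻ η, partialProd g n (s, η) ∂Measure.infinitePi (fun _ : Idx => P) =
      ∏ k ∈ Finset.range n, ∏ j ∈ Finset.range (s k).1, ∫⁻ e, g ((s k).2 j, e) ∂P := by
  obtain ⟨I, hI⟩ := exists_finset_pairs s n
  have h := lintegral_prod_infinitePi (fun _ : Idx => P) I
    (φ := fun i e => g (s.loc i, e)) (fun i => by fun_prop)
  rw [Finset.prod_finset_product I _ (fun k => Finset.range (s k).1) hI] at h
  simp only [Sample.loc] at h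
  rw [← h]
  congr 1 with η
  rw [Finset.prod_finset_product I _ (fun k => Finset.range (s k).1) hI]
  rfl

/-! ### Poisson samples of finite intensity. -/

/-- The law of the individual points of a sample of finite intensity. -/
noncomputable def pointLaw (m : Measure (Space d)) [IsFiniteMeasure m] : Measure (Space d) :=
  ((FiniteMeasure.normalize ⟨m, inferInstance⟩ : ProbabilityMeasure (Space d)) : Measure (Space d))

instance (m : Measure (Space d)) [IsFiniteMeasure m] : IsProbabilityMeasure (pointLaw m) := by
  unfold pointLaw; infer_instance

theorem mass_smul_pointLaw (m : Measure (Space d)) [IsFiniteMeasure m] :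
    (m Set.univ).toNNReal • pointLaw m = m := by
  have h := FiniteMeasure.self_eq_mass_smul_normalize (⟨m, inferInstance⟩ : FiniteMeasure (Space d))
  have h2 := congrArg (fun x : FiniteMeasure (Space d) => (x : Measure (Space d))) h
  exact h2.symm

theorem measurable_prod_range {R : Type*} [CommMonoid R] [MeasurableSpace R] [MeasurableMul₂ R]
    {φ : Space d → R} (hφ : Measurable φ) :
    Measurable fun q : ℕ × (ℕ → Space d) => ∏ j ∈ Finset.range q.1, φ (q.2 j) :=
  measurable_nat_comp (F := fun N (q : ℕ × (ℕ → Space d)) => ∏ j ∈ Finset.range N, φ (q.2 j))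
    measurable_fst fun N => by fun_prop

theorem lintegral_prod_finitePoissonLaw (m : Measure (Space d)) [IsFiniteMeasure m]
    {φ : Space d → ℝ≥0∞} (hφ : Measurable φ) :
    ∫⁻ q, ∏ j ∈ Finset.range q.1, φ (q.2 j) ∂finitePoissonLaw m =
      ∫⁻ N, (∫⁻ x, φ x ∂pointLaw m) ^ N ∂poissonMeasure (m Set.univ).toNNReal := by
  unfold finitePoissonLaw
  rw [lintegral_prod _ (measurable_prod_range hφ).aemeasurable]
  congr 1 with N
  have := lintegral_prod_infinitePi (fun _ : ℕ => pointLaw m) (Finset.range N)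
    (φ := fun _ => φ) (fun _ => hφ)
  simp only [Finset.prod_const, Finset.card_range] at this
  exact this

theorem integral_prod_finitePoissonLaw (m : Measure (Space d)) [IsFiniteMeasure m]
    {φ : Space d → ℝ} (hφ : Measurable φ)
    (h : (m Set.univ).toNNReal = 0 ∨ Integrable φ (pointLaw m)) :
    ∫ q, ∏ j ∈ Finset.range q.1, φ (q.2 j) ∂finitePoissonLaw m =
      Real.exp ((m Set.univ).toNNReal * (∫ x, φ x ∂pointLaw m - 1)) := by
  have hi : Integrable (fun q : ℕ × (ℕ → Space d) => ∏ j ∈ Finset.range q.1, φ (q.2 j))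
      (finitePoissonLaw m) := by
    refine ⟨(measurable_prod_range hφ).aestronglyMeasurable, ?_⟩
    have := lintegral_prod_finitePoissonLaw m (φ := fun x => ‖φ x‖ₑ) (by fun_prop)
    simp only [HasFiniteIntegral, enorm_finset_prod]
    rw [this]
    exact lintegral_pow_poissonMeasure_lt_top (h.imp_right fun h => h.2.ne)
  unfold finitePoissonLaw at hi ⊢
  rw [integral_prod _ hi, ← integral_pow_poissonMeasure]
  congr 1 with N
  have := integral_prod_infinitePi (fun _ : ℕ => pointLaw m) (Finset.range N)
    (φ := fun _ => φ) (fun _ => hφ)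
  simp only [Finset.prod_const, Finset.card_range] at this
  exact this

/-! ### The exponential formula for finitely many pieces. -/

/-- The law of a Poisson sample of intensity `ν` with independent marks of law `P`. -/
noncomputable def markedLaw (ν : Measure (Space d)) [SFinite ν] (P : Measure E)
    [IsProbabilityMeasure P] : Measure (Sample d × (Idx → E)) :=
  (poissonLaw ν).prod (Measure.infinitePi fun _ : Idx => P)

instance (ν : Measure (Space d)) [SFinite ν] (P : Measure E) [IsProbabilityMeasure P] :
    IsProbabilityMeasure (markedLaw ν P) := by
  unfold markedLaw; infer_instance

variable (ν : Measure (Space d)) [SFinite ν] (P : Measure E) [IsProbabilityMeasure P]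

theorem lintegral_partialProd {g : Space d × E → ℝ≥0∞} (hg : Measurable g) (n : ℕ) :
    ∫⁻ p, partialProd g n p ∂markedLaw ν P =
      ∏ k ∈ Finset.range n, ∫⁻ N, (∫⁻ q, g q ∂(pointLaw (sfiniteSeq ν k)).prod P) ^ N
        ∂poissonMeasure (sfiniteSeq ν k Set.univ).toNNReal := by
  unfold markedLaw
  rw [lintegral_prod _ (measurable_partialProd hg n).aemeasurable]
  simp_rw [lintegral_partialProd_marks P hg n]
  have hm : Measurable fun x => ∫⁻ e, g (x, e) ∂P := hg.lintegral_prod_right'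
  unfold poissonLaw
  rw [lintegral_prod_infinitePi (fun k => finitePoissonLaw (sfiniteSeq ν k)) (Finset.range n)
    (φ := fun _ q => ∏ j ∈ Finset.range q.1, ∫⁻ e, g (q.2 j, e) ∂P)
    (fun k => measurable_prod_range hm)]
  refine Finset.prod_congr rfl fun k _ => ?_
  rw [lintegral_prod_finitePoissonLaw _ hm, lintegral_prod _ hg.aemeasurable]

theorem prod_eq_mass_smul (m : Measure (Space d)) [IsFiniteMeasure m] :
    m.prod P = (m Set.univ).toNNReal • (pointLaw m).prod P := by
  conv_lhs => rw [← mass_smul_pointLaw m]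
  exact Measure.prod_smul_left _

theorem mass_eq_zero_or_integrable {m : Measure (Space d)} [IsFiniteMeasure m]
    {g : Space d × E → ℝ} (h : Integrable g (m.prod P)) :
    (m Set.univ).toNNReal = 0 ∨ Integrable g ((pointLaw m).prod P) := by
  refine or_iff_not_imp_left.2 fun h0 => ?_
  rw [prod_eq_mass_smul] at h
  exact (integrable_smul_measure (by exact_mod_cast h0) (by simp)).1 h

theorem integrable_partialProd {g : Space d × E → ℝ} (hg : Measurable g)
    (hi : ∀ k, Integrable g ((sfiniteSeq ν k).prod P)) (n : ℕ) :
    Integrable (partialProd g n) (markedLaw ν P) := by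
  refine ⟨(measurable_partialProd hg n).aestronglyMeasurable, ?_⟩
  have h := lintegral_partialProd ν P (g := fun q => ‖g q‖ₑ) (by fun_prop) n
  have h2 : ∀ p, ‖partialProd g n p‖ₑ = partialProd (fun q => ‖g q‖ₑ) n p := fun p => by
    simp [partialProd, enorm_finset_prod]
  simp only [HasFiniteIntegral, h2]
  rw [h]
  refine ENNReal.prod_lt_top fun k _ => lintegral_pow_poissonMeasure_lt_top ?_
  exact (mass_eq_zero_or_integrable P (hi k)).imp_right fun h => h.2.ne

/-- Marks are integrated out given the sample, pieces are independent, and each piece contributes a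
Poisson generating function `exp (r (a - 1))`, with `r` its mass and `a` the mean of `g` at a marked
point. -/
theorem integral_partialProd {g : Space d × E → ℝ} (hg : Measurable g)
    (hi : ∀ k, Integrable g ((sfiniteSeq ν k).prod P)) (n : ℕ) :
    ∫ p, partialProd g n p ∂markedLaw ν P =
      Real.exp (∑ k ∈ Finset.range n, ∫ q, (g q - 1) ∂(sfiniteSeq ν k).prod P) := by
  have hint := integrable_partialProd ν P hg hi n
  unfold markedLaw at hint ⊢
  rw [integral_prod _ hint]
  simp_rw [integral_partialProd_marks P hg n]
  have hm : Measurable fun x => ∫ e, g (x, e) ∂P :=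
    hg.stronglyMeasurable.integral_prod_right'.measurable
  unfold poissonLaw
  rw [integral_prod_infinitePi (fun k => finitePoissonLaw (sfiniteSeq ν k)) (Finset.range n)
    (φ := fun _ q => ∏ j ∈ Finset.range q.1, ∫ e, g (q.2 j, e) ∂P)
    (fun k => measurable_prod_range hm), Real.exp_sum]
  refine Finset.prod_congr rfl fun k _ => ?_
  have h1 := mass_eq_zero_or_integrable P (hi k)
  rw [integral_prod_finitePoissonLaw _ hm (h1.imp_right fun h => h.integral_prod_left)]
  congr 1
  rcases h1 with h1 | h1
  · rw [prod_eq_mass_smul, h1]; simp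
  · rw [prod_eq_mass_smul, integral_smul_nnreal_measure, integral_sub h1 (integrable_const _),
      integral_prod _ h1]
    simp [NNReal.smul_def]

end Marked

section Marked

variable {d : ℕ} {E : Type*}

/-! ### Convergence of the partial products -/

open Classical in
/-- The value of `g` at the marked point of index `i`, and `1` if this point is absent. -/
noncomputable def markedFactor (g : Space d × E → ℝ) (p : Sample d × (Idx → E)) (i : Idx) : ℝ :=
  if p.1.Present i then g (p.1.loc i, p.2 i) else 1

theorem markedFactor_comp {φ : ℝ → ℝ} (hφ : φ 1 = 1) (g : Space d × E → ℝ)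
    (p : Sample d × (Idx → E)) (i : Idx) :
    markedFactor (fun q => φ (g q)) p i = φ (markedFactor g p i) := by
  unfold markedFactor; split_ifs <;> simp [hφ]

/-- Unconditional convergence allows multiplying piece by piece; within a piece only finitely many
factors differ from `1`. -/
theorem tendsto_partialProd_of_hasProd {g : Space d × E → ℝ} {p : Sample d × (Idx → E)} {t : ℝ}
    (h : HasProd (markedFactor g p) t) : Tendsto (fun n => partialProd g n p) atTop (𝓝 t) := by
  refine (h.prod_fiberwise (g := fun k =>
    ∏ j ∈ Finset.range (p.1 k).1, g ((p.1 k).2 j, p.2 (k, j))) fun k => ?_).tendsto_prod_nat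
  have h1 : ∀ j ∉ Finset.range (p.1 k).1, markedFactor g p (k, j) = 1 := fun j hj => by
    simp only [Finset.mem_range] at hj
    simp [markedFactor, Sample.Present, hj]
  convert (hasProd_prod_of_ne_finset_one h1 : HasProd _ _ (SummationFilter.unconditional ℕ)) using 1
  refine Finset.prod_congr rfl fun j hj => ?_
  simp only [Finset.mem_range] at hj
  simp [markedFactor, Sample.Present, Sample.loc, hj]

theorem multipliable_of_summable_abs_sub_one {ι : Type*} {w : ι → ℝ}
    (h : Summable fun i => |w i - 1|) : Multipliable w := by
  have := multipliable_one_add_of_summable (f := fun i => w i - 1) h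
  simpa using this

theorem one_le_partialProd {g : Space d × E → ℝ} (hg : ∀ q, 1 ≤ g q) (n : ℕ)
    (p : Sample d × (Idx → E)) : 1 ≤ partialProd g n p :=
  Finset.one_le_prod fun _ _ => Finset.one_le_prod fun _ _ => hg _

theorem monotone_partialProd {g : Space d × E → ℝ} (hg : ∀ q, 1 ≤ g q)
    (p : Sample d × (Idx → E)) : Monotone fun n => partialProd g n p := by
  refine monotone_nat_of_le_succ fun n => ?_
  have h1 := one_le_partialProd hg n p
  simp only [partialProd, Finset.prod_range_succ] at h1 ⊢
  exact le_mul_of_one_le_right (by linarith) (Finset.one_le_prod fun _ _ => hg _)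

theorem partialProd_le_partialProd {g g' : Space d × E → ℝ} (h0 : ∀ q, 0 ≤ g q)
    (h : ∀ q, g q ≤ g' q) (n : ℕ) (p : Sample d × (Idx → E)) :
    partialProd g n p ≤ partialProd g' n p := by
  unfold partialProd
  gcongr with k _ j _
  · exact fun i _ => Finset.prod_nonneg fun _ _ => h0 _
  · exact fun i _ => h0 _
  · exact h _

theorem abs_partialProd (g : Space d × E → ℝ) (n : ℕ) (p : Sample d × (Idx → E)) :
    |partialProd g n p| = partialProd (fun q => |g q|) n p := by
  simp [partialProd, Finset.abs_prod]

theorem partialProd_mem_Icc {g : Space d × E → ℝ} (h01 : ∀ q, g q ∈ Set.Icc (0 : ℝ) 1) (n : ℕ)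
    (p : Sample d × (Idx → E)) : partialProd g n p ∈ Set.Icc (0 : ℝ) 1 := by
  refine ⟨Finset.prod_nonneg fun _ _ => Finset.prod_nonneg fun _ _ => (h01 _).1, ?_⟩
  refine (partialProd_le_partialProd (g' := fun _ => 1) (fun q => (h01 q).1) (fun q => (h01 q).2)
    n p).trans (by simp [partialProd])

variable [MeasurableSpace E]
variable (ν : Measure (Space d)) [SFinite ν] (P : Measure E) [IsProbabilityMeasure P]

theorem sum_sfiniteSeq_prod :
    Measure.sum (fun k => (sfiniteSeq ν k).prod P) = ν.prod P := by
  conv_rhs => rw [← sum_sfiniteSeq ν]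
  exact (Measure.prod_sum_left _ _).symm

theorem sfiniteSeq_prod_le (k : ℕ) : (sfiniteSeq ν k).prod P ≤ ν.prod P := by
  rw [← sum_sfiniteSeq_prod ν P]
  exact Measure.le_sum (fun k => (sfiniteSeq ν k).prod P) k

theorem aestronglyMeasurable_of_tendsto_partialProd {g : Space d × E → ℝ} (hg : Measurable g)
    {T : Sample d × (Idx → E) → ℝ}
    (hT : ∀ᵐ p ∂markedLaw ν P, Tendsto (fun n => partialProd g n p) atTop (𝓝 (T p))) :
    AEStronglyMeasurable T (markedLaw ν P) :=
  aestronglyMeasurable_of_tendsto_ae atTop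
    (fun n => (measurable_partialProd hg n).aestronglyMeasurable) hT

/-! ### Functions with values in the unit interval -/

theorem integrable_of_tendsto_partialProd_of_mem_Icc {g : Space d × E → ℝ} (hg : Measurable g)
    (h01 : ∀ q, g q ∈ Set.Icc (0 : ℝ) 1) {T : Sample d × (Idx → E) → ℝ}
    (hT : ∀ᵐ p ∂markedLaw ν P, Tendsto (fun n => partialProd g n p) atTop (𝓝 (T p))) :
    Integrable T (markedLaw ν P) := by
  refine Integrable.of_bound (aestronglyMeasurable_of_tendsto_partialProd ν P hg hT) 1 ?_
  filter_upwards [hT] with p hp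
  have := isClosed_Icc.mem_of_tendsto hp (.of_forall fun n => partialProd_mem_Icc h01 n p)
  rw [Real.norm_eq_abs, abs_le]
  constructor <;> linarith [this.1, this.2]

/-- The partial products are dominated by `1`. Stating the limit through `EReal.exp` covers a
divergent integral, for which both sides vanish. -/
theorem ofReal_integral_of_mem_Icc {g : Space d × E → ℝ} (hg : Measurable g)
    (h01 : ∀ q, g q ∈ Set.Icc (0 : ℝ) 1) {T : Sample d × (Idx → E) → ℝ}
    (hT : ∀ᵐ p ∂markedLaw ν P, Tendsto (fun n => partialProd g n p) atTop (𝓝 (T p))) :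
    ENNReal.ofReal (∫ p, T p ∂markedLaw ν P) =
      EReal.exp (-((∫⁻ q, ENNReal.ofReal (1 - g q) ∂ν.prod P : ℝ≥0∞) : EReal)) := by
  have hi : ∀ k, Integrable g ((sfiniteSeq ν k).prod P) := fun k =>
    Integrable.of_bound hg.aestronglyMeasurable 1 (.of_forall fun q => by
      rw [Real.norm_eq_abs, abs_le]; constructor <;> linarith [(h01 q).1, (h01 q).2])
  have hlim : Tendsto (fun n => ∫ p, partialProd g n p ∂markedLaw ν P) atTop
      (𝓝 (∫ p, T p ∂markedLaw ν P)) := by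
    refine tendsto_integral_of_dominated_convergence (fun _ => 1)
      (fun n => (measurable_partialProd hg n).aestronglyMeasurable) (integrable_const _)
      (fun n => .of_forall fun p => ?_) hT
    have := partialProd_mem_Icc h01 n p
    rw [Real.norm_eq_abs, abs_le]; constructor <;> linarith [this.1, this.2]
  refine tendsto_nhds_unique ((ENNReal.continuous_ofReal.tendsto _).comp hlim) ?_
  have h1 : ∀ n, ENNReal.ofReal (∫ p, partialProd g n p ∂markedLaw ν P) =
      EReal.exp (-((∑ k ∈ Finset.range n,
        ∫⁻ q, ENNReal.ofReal (1 - g q) ∂(sfiniteSeq ν k).prod P : ℝ≥0∞) : EReal)) := fun n => by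
    have h0 : ∀ k, 0 ≤ ∫ q, (1 - g q) ∂(sfiniteSeq ν k).prod P := fun k =>
      integral_nonneg fun q => sub_nonneg.2 (h01 q).2
    have h2 : ∀ k, ∫⁻ q, ENNReal.ofReal (1 - g q) ∂(sfiniteSeq ν k).prod P =
        ENNReal.ofReal (∫ q, (1 - g q) ∂(sfiniteSeq ν k).prod P) := fun k =>
      (ofReal_integral_eq_lintegral_ofReal ((integrable_const _).sub (hi k))
        (.of_forall fun q => sub_nonneg.2 (h01 q).2)).symm
    simp_rw [h2]
    rw [← ENNReal.ofReal_sum_of_nonneg fun k _ => h0 k, EReal.coe_ennreal_ofReal,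
      max_eq_left (Finset.sum_nonneg fun k _ => h0 k), ← EReal.coe_neg, EReal.exp_coe,
      integral_partialProd ν P hg hi, ← Finset.sum_neg_distrib]
    simp_rw [← integral_neg, neg_sub]
  simp only [Function.comp_def, h1]
  rw [← sum_sfiniteSeq_prod, lintegral_sum_measure]
  exact (EReal.expHomeomorph.continuous.tendsto _).comp ((continuous_neg.tendsto _).comp
    ((continuous_coe_ennreal_ereal.tendsto _).comp ENNReal.summable.hasSum.tendsto_sum_nat))

/-- The product of the indicator of `B` over the marked points is almost surely `1`, so the
exponential formula gives `1 = exp (-(ν ⊗ P)(Bᶜ))`. -/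
theorem ae_prod_of_ae_markedLaw {B : Set (Space d × E)} (hB : MeasurableSet B)
    (h : ∀ᵐ p ∂markedLaw ν P, ∀ i, p.1.Present i → (p.1.loc i, p.2 i) ∈ B) :
    ∀ᵐ q ∂ν.prod P, q ∈ B := by
  have hg : Measurable (B.indicator fun _ => (1 : ℝ)) := measurable_const.indicator hB
  have h01 : ∀ q, B.indicator (fun _ => (1 : ℝ)) q ∈ Set.Icc (0 : ℝ) 1 := fun q => by
    by_cases hq : q ∈ B <;> simp [hq]
  have hT := ofReal_integral_of_mem_Icc ν P hg h01 (T := fun _ => 1) (by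
    filter_upwards [h] with p hp
    refine tendsto_partialProd_of_hasProd ?_
    have : markedFactor (B.indicator fun _ => (1 : ℝ)) p = fun _ => 1 := by
      ext i
      unfold markedFactor
      split_ifs with hi
      · simp [hp i hi]
      · rfl
    rw [this]
    exact hasProd_one)
  simp only [integral_const, probReal_univ, smul_eq_mul, mul_one, ENNReal.ofReal_one] at hT
  have h0 : (0 : EReal) ≤ -((∫⁻ q, ENNReal.ofReal (1 - B.indicator (fun _ => (1 : ℝ)) q) ∂ν.prod P :
      ℝ≥0∞) : EReal) := EReal.one_le_exp_iff.1 hT.le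
  have h1 : ∫⁻ q, ENNReal.ofReal (1 - B.indicator (fun _ => (1 : ℝ)) q) ∂ν.prod P = 0 := by
    rw [EReal.le_neg, neg_zero] at h0
    exact_mod_cast le_antisymm h0 (EReal.coe_ennreal_nonneg _)
  rw [lintegral_eq_zero_iff (by fun_prop)] at h1
  filter_upwards [h1] with q hq
  by_contra hqB
  simp [hqB] at hq

/-! ### Integrable functions -/

theorem integrable_of_integrable_sub_one {g : Space d × E → ℝ}
    (hi : Integrable (fun q => g q - 1) (ν.prod P)) (k : ℕ) :
    Integrable g ((sfiniteSeq ν k).prod P) := by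
  have := (hi.mono_measure (sfiniteSeq_prod_le ν P k)).add (integrable_const (1 : ℝ))
  exact this.congr (.of_forall fun q => by simp)

theorem hasSum_integral_sfiniteSeq_prod {g : Space d × E → ℝ} (hi : Integrable g (ν.prod P)) :
    HasSum (fun k => ∫ q, g q ∂(sfiniteSeq ν k).prod P) (∫ q, g q ∂ν.prod P) := by
  rw [← sum_sfiniteSeq_prod] at hi ⊢
  exact hasSum_integral_measure hi

/-- Provides the dominating function for the integrable case: the partial products increase, and
their means stay below `exp ∫ (g - 1)`. -/
theorem lintegral_iSup_partialProd_lt_top {g : Space d × E → ℝ} (hg : Measurable g)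
    (h1 : ∀ q, 1 ≤ g q) (hi : Integrable (fun q => g q - 1) (ν.prod P)) :
    ∫⁻ p, ⨆ n, ENNReal.ofReal (partialProd g n p) ∂markedLaw ν P < ∞ := by
  rw [lintegral_iSup (fun n => (measurable_partialProd hg n).ennreal_ofReal)
    fun m n hmn p => ENNReal.ofReal_le_ofReal (monotone_partialProd h1 p hmn)]
  have hk := integrable_of_integrable_sub_one ν P hi
  refine (iSup_le fun n => ?_).trans_lt
    (ENNReal.ofReal_lt_top (r := Real.exp (∫ q, (g q - 1) ∂ν.prod P)))
  rw [← ofReal_integral_eq_lintegral_ofReal (integrable_partialProd ν P hg hk n)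
    (.of_forall fun p => zero_le_one.trans (one_le_partialProd h1 n p)),
    integral_partialProd ν P hg hk n]
  refine ENNReal.ofReal_le_ofReal (Real.exp_le_exp.2 ?_)
  exact sum_le_hasSum _ (fun k _ => integral_nonneg fun q => sub_nonneg.2 (h1 q))
    (hasSum_integral_sfiniteSeq_prod ν P hi)

theorem integral_of_integrable_sub_one {g : Space d × E → ℝ} (hg : Measurable g)
    (hi : Integrable (fun q => g q - 1) (ν.prod P)) {T : Sample d × (Idx → E) → ℝ}
    (hT : ∀ᵐ p ∂markedLaw ν P, Tendsto (fun n => partialProd g n p) atTop (𝓝 (T p))) :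
    Integrable T (markedLaw ν P) ∧
      ∫ p, T p ∂markedLaw ν P = Real.exp (∫ q, (g q - 1) ∂ν.prod P) := by
  -- A majorant of `|g|` that is at least `1` and whose distance to `1` is still integrable.
  set g' : Space d × E → ℝ := fun q => 1 + |g q - 1|
  have hg' : Measurable g' := by fun_prop
  have hg'1 : ∀ q, 1 ≤ g' q := fun q => le_add_of_nonneg_right (abs_nonneg _)
  have hi' : Integrable (fun q => g' q - 1) (ν.prod P) := by
    simpa [g'] using hi.abs
  have hgg' : ∀ q, |g q| ≤ g' q := fun q => by
    have := abs_add_le 1 (g q - 1); simpa using this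
  set D : Sample d × (Idx → E) → ℝ≥0∞ := fun p => ⨆ n, ENNReal.ofReal (partialProd g' n p)
  have hDm : Measurable D :=
    Measurable.iSup fun n => (measurable_partialProd hg' n).ennreal_ofReal
  have hD := lintegral_iSup_partialProd_lt_top ν P hg' hg'1 hi'
  have hDi : Integrable (fun p => (D p).toReal) (markedLaw ν P) :=
    integrable_toReal_of_lintegral_ne_top hDm.aemeasurable hD.ne
  have hbound : ∀ᵐ p ∂markedLaw ν P, ∀ n, ‖partialProd g n p‖ ≤ (D p).toReal := by
    filter_upwards [ae_lt_top hDm hD.ne] with p hp n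
    rw [Real.norm_eq_abs, abs_partialProd]
    refine (partialProd_le_partialProd (fun q => abs_nonneg _) hgg' n p).trans ?_
    exact (ENNReal.ofReal_le_iff_le_toReal hp.ne).1 (le_iSup (f := fun n =>
      ENNReal.ofReal (partialProd g' n p)) n)
  refine ⟨hDi.mono' (aestronglyMeasurable_of_tendsto_partialProd ν P hg hT) ?_, ?_⟩
  · filter_upwards [hbound, hT] with p hp hTp
    exact le_of_tendsto hTp.norm (.of_forall hp)
  · refine tendsto_nhds_unique (tendsto_integral_of_dominated_convergence _
      (fun n => (measurable_partialProd hg n).aestronglyMeasurable) hDi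
      (fun n => hbound.mono fun p hp => hp n) hT) ?_
    simp_rw [integral_partialProd ν P hg (integrable_of_integrable_sub_one ν P hi)]
    exact (Real.continuous_exp.tendsto _).comp
      (hasSum_integral_sfiniteSeq_prod ν P hi).tendsto_sum_nat

/-! ### Absolutely convergent products with finite expectation -/

theorem min_one_le_two_mul_one_sub_exp_neg {t : ℝ} (ht : 0 ≤ t) :
    min t 1 ≤ 2 * (1 - Real.exp (-t)) := by
  have h1 : Real.exp (-t) ≤ 1 / (1 + t) := by
    rw [Real.exp_neg, one_div]
    exact inv_anti₀ (by positivity) (by linarith [Real.add_one_le_exp t])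
  have h2 : min t 1 ≤ 2 * (1 - 1 / (1 + t)) := by
    rw [show 2 * (1 - 1 / (1 + t)) = 2 * t / (1 + t) by field_simp; ring,
      le_div_iff₀ (by positivity)]
    rcases min_cases t 1 with ⟨h, h'⟩ | ⟨h, h'⟩ <;> rw [h] <;> nlinarith
  linarith

/-- The sum is almost surely finite, so `E exp (-∑ |h - 1|)` is positive. By the exponential formula
this mean is `exp (-∫ (1 - exp (-|h - 1|)))`, hence that integral is finite. -/
theorem integrable_min_abs_sub_one {h : Space d × E → ℝ} (hh : Measurable h)
    (hs : ∀ᵐ p ∂markedLaw ν P, Summable fun i => |markedFactor h p i - 1|) :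
    Integrable (fun q => min |h q - 1| 1) (ν.prod P) := by
  set g : Space d × E → ℝ := fun q => Real.exp (-|h q - 1|)
  have hg : Measurable g := by fun_prop
  have h01 : ∀ q, g q ∈ Set.Icc (0 : ℝ) 1 := fun q =>
    ⟨(Real.exp_pos _).le, Real.exp_le_one_iff.2 (neg_nonpos.2 (abs_nonneg _))⟩
  have hT : ∀ᵐ p ∂markedLaw ν P, Tendsto (fun n => partialProd g n p) atTop
      (𝓝 (Real.exp (-∑' i, |markedFactor h p i - 1|))) := by
    filter_upwards [hs] with p hp
    refine tendsto_partialProd_of_hasProd ?_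
    have := hp.hasSum.neg.rexp
    convert this using 1
    ext i
    exact markedFactor_comp (φ := fun t => Real.exp (-|t - 1|)) (by simp) h p i
  have hpos : 0 < ∫ p, Real.exp (-∑' i, |markedFactor h p i - 1|) ∂markedLaw ν P :=
    integral_exp_pos (integrable_of_tendsto_partialProd_of_mem_Icc ν P hg h01 hT)
  have heq := ofReal_integral_of_mem_Icc ν P hg h01 hT
  have hlt : ∫⁻ q, ENNReal.ofReal (1 - g q) ∂ν.prod P ≠ ∞ := by
    intro htop
    rw [htop] at heq
    simp only [EReal.coe_ennreal_top, EReal.neg_top, EReal.exp_bot, ENNReal.ofReal_eq_zero] at heq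
    linarith
  have hint : Integrable (fun q => 1 - g q) (ν.prod P) := by
    refine ⟨by fun_prop, ?_⟩
    rw [hasFiniteIntegral_iff_ofReal (.of_forall fun q => sub_nonneg.2 (h01 q).2)]
    exact hlt.lt_top
  refine (hint.const_mul 2).mono' (by fun_prop) (.of_forall fun q => ?_)
  rw [Real.norm_of_nonneg (le_min (abs_nonneg _) zero_le_one)]
  exact min_one_le_two_mul_one_sub_exp_neg (abs_nonneg _)

/-- Truncating `|x|` at a level `M ≥ 1` fixes `1` and is `1`-Lipschitz, so absolute convergence of
products survives. -/
theorem abs_min_abs_sub_one_le (x : ℝ) {M : ℝ} (hM : 1 ≤ M) : |min |x| M - 1| ≤ |x - 1| := by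
  have h1 := abs_abs_sub_abs_le x 1
  rw [abs_one] at h1
  refine le_trans ?_ h1
  rcases min_cases |x| M with ⟨h, h'⟩ | ⟨h, h'⟩ <;> rw [h]
  rw [abs_of_nonneg (by linarith), abs_of_nonneg (by linarith)]
  linarith

theorem abs_min_abs_sub_one_le_mul (x : ℝ) {M : ℝ} (hM : 1 ≤ M) :
    |min |x| M - 1| ≤ M * min |x - 1| 1 := by
  have h1 := abs_min_abs_sub_one_le x hM
  rcases min_cases |x - 1| 1 with ⟨h, h'⟩ | ⟨h, h'⟩ <;> rw [h]
  · exact h1.trans (le_mul_of_one_le_left (abs_nonneg _) hM)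
  · have h2 : 0 ≤ min |x| M := le_min (abs_nonneg _) (by linarith)
    have h3 : min |x| M ≤ M := min_le_right _ _
    rw [abs_le]
    constructor <;> linarith

theorem zero_le_min_abs_sub_one_add (x : ℝ) {M : ℝ} (hM : 1 ≤ M) :
    0 ≤ min |x| M - 1 + min |x - 1| 1 := by
  have h1 := abs_min_abs_sub_one_le x hM
  have h2 : 0 ≤ min |x| M := le_min (abs_nonneg _) (by linarith)
  have h3 := (abs_le.1 h1).1
  rcases min_cases |x - 1| 1 with ⟨h, h'⟩ | ⟨h, h'⟩ <;> rw [h] <;> linarith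

theorem abs_sub_one_le (x : ℝ) : |x - 1| ≤ (|x| - 1 + min |x - 1| 1) + min |x - 1| 1 := by
  rcases min_cases |x - 1| 1 with ⟨h, h'⟩ | ⟨h, h'⟩ <;> rw [h]
  · have := (abs_le.1 (abs_abs_sub_abs_le x 1)).1
    rw [abs_one] at this
    linarith
  · have := abs_sub x 1
    rw [abs_one] at this
    linarith

/-- The truncations `hM M` of `|h|` satisfy the exponential formula, and their products are at most
`|T|`. This bounds `∫ (hM M - 1)` uniformly in `M`, and monotone convergence concludes. -/
theorem integrable_sub_one_of_integrable {h : Space d × E → ℝ} (hh : Measurable h)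
    (hs : ∀ᵐ p ∂markedLaw ν P, Summable fun i => |markedFactor h p i - 1|)
    {T : Sample d × (Idx → E) → ℝ} (hTi : Integrable T (markedLaw ν P))
    (hT : ∀ᵐ p ∂markedLaw ν P, Tendsto (fun n => partialProd h n p) atTop (𝓝 (T p))) :
    Integrable (fun q => h q - 1) (ν.prod P) := by
  set φ : Space d × E → ℝ := fun q => min |h q - 1| 1
  have hφm : Measurable φ := by fun_prop
  have hφ : Integrable φ (ν.prod P) := integrable_min_abs_sub_one ν P hh hs
  have hM1 : ∀ M : ℕ, (1 : ℝ) ≤ (M : ℝ) + 1 := fun M => by simp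
  set hM : ℕ → Space d × E → ℝ := fun M q => min |h q| ((M : ℝ) + 1)
  have hMm : ∀ M, Measurable (hM M) := fun M => by fun_prop
  have hMi : ∀ M, Integrable (fun q => hM M q - 1) (ν.prod P) := fun M =>
    (hφ.const_mul ((M : ℝ) + 1)).mono' ((hMm M).sub_const 1).aestronglyMeasurable
      (.of_forall fun q => abs_min_abs_sub_one_le_mul (h q) (hM1 M))
  have hTM : ∀ M, ∀ᵐ p ∂markedLaw ν P, Tendsto (fun n => partialProd (hM M) n p) atTop
      (𝓝 (∏' i, markedFactor (hM M) p i)) := fun M => by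
    filter_upwards [hs] with p hp
    refine tendsto_partialProd_of_hasProd (Multipliable.hasProd ?_)
    refine multipliable_of_summable_abs_sub_one (hp.of_nonneg_of_le (fun i => abs_nonneg _) ?_)
    intro i
    rw [markedFactor_comp (φ := fun t => min |t| ((M : ℝ) + 1)) (by simp)]
    exact abs_min_abs_sub_one_le _ (hM1 M)
  have hle : ∀ M, ∫ q, (hM M q - 1) ∂ν.prod P ≤ ∫ p, |T p| ∂markedLaw ν P := fun M => by
    obtain ⟨h1, h2⟩ := integral_of_integrable_sub_one ν P (hMm M) (hMi M) (hTM M)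
    have h3 : ∫ p, ∏' i, markedFactor (hM M) p i ∂markedLaw ν P ≤
        ∫ p, |T p| ∂markedLaw ν P := by
      refine integral_mono_ae h1 hTi.abs ?_
      filter_upwards [hT, hTM M] with p hp hpM
      refine le_of_tendsto_of_tendsto' hpM hp.abs fun n => ?_
      rw [abs_partialProd]
      exact partialProd_le_partialProd (fun q => le_min (abs_nonneg _) (by linarith [hM1 M]))
        (fun q => min_le_left _ _) n p
    -- Using `x ≤ exp x - 1` instead of a logarithm avoids asking that `E|T|` be positive.
    have h4 := Real.add_one_le_exp (∫ q, (hM M q - 1) ∂ν.prod P)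
    linarith
  -- Adding the integrable `φ` makes the integrands nonnegative, as monotone convergence requires.
  have hlint : ∀ M, ∫⁻ q, ENNReal.ofReal (hM M q - 1 + φ q) ∂ν.prod P ≤
      ENNReal.ofReal (∫ p, |T p| ∂markedLaw ν P + ∫ q, φ q ∂ν.prod P) := fun M => by
    rw [← ofReal_integral_eq_lintegral_ofReal (f := fun q => hM M q - 1 + φ q) ((hMi M).add hφ)
      (.of_forall fun q => zero_le_min_abs_sub_one_add (h q) (hM1 M)),
      integral_add (hMi M) hφ]
    exact ENNReal.ofReal_le_ofReal (by linarith [hle M])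
  have hfin : ∫⁻ q, ENNReal.ofReal (|h q| - 1 + φ q) ∂ν.prod P ≤
      ENNReal.ofReal (∫ p, |T p| ∂markedLaw ν P + ∫ q, φ q ∂ν.prod P) := by
    refine le_of_tendsto' (lintegral_tendsto_of_tendsto_of_monotone
      (f := fun M q => ENNReal.ofReal (hM M q - 1 + φ q))
      (fun M => (((hMm M).sub_const 1).add hφm).ennreal_ofReal.aemeasurable) ?_ ?_) hlint
    · refine .of_forall fun q M N hMN => ENNReal.ofReal_le_ofReal ?_
      have : hM M q ≤ hM N q := min_le_min_left _ (by simpa using hMN)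
      linarith
    · refine .of_forall fun q => tendsto_const_nhds.congr' ?_
      filter_upwards [eventually_ge_atTop ⌈|h q|⌉₊] with M hq
      have : |h q| ≤ (M : ℝ) + 1 := (Nat.le_ceil _).trans (by
        have : ((⌈|h q|⌉₊ : ℕ) : ℝ) ≤ M := by exact_mod_cast hq
        linarith)
      simp only [hM, min_eq_left this]
  have habs : Integrable (fun q => |h q| - 1 + φ q) (ν.prod P) := by
    refine ⟨by fun_prop, ?_⟩
    rw [hasFiniteIntegral_iff_ofReal (.of_forall fun q => ?_)]
    · exact hfin.trans_lt ENNReal.ofReal_lt_top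
    -- At the level `max |h q| 1` the truncation does nothing.
    · have := zero_le_min_abs_sub_one_add (h q) (le_max_right |h q| 1)
      rw [min_eq_left (le_max_left _ _)] at this
      exact this
  exact (habs.add hφ).mono' (by fun_prop) (.of_forall fun q => abs_sub_one_le (h q))

end Marked

/-! ### Infinite products of real numbers -/

theorem multipliable_of_mem_Icc {ι : Type*} {w : ι → ℝ} (h : ∀ i, w i ∈ Set.Icc (0 : ℝ) 1) :
    Multipliable w := by
  classical
  have h0 : ∀ s : Finset ι, 0 ≤ ∏ i ∈ s, w i := fun s => Finset.prod_nonneg fun i _ => (h i).1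
  refine ⟨_, tendsto_atTop_ciInf (f := fun s : Finset ι => ∏ i ∈ s, w i) (fun s t hst => ?_)
    ⟨0, by rintro _ ⟨s, rfl⟩; exact h0 s⟩⟩
  simp only
  rw [← Finset.prod_sdiff hst]
  exact mul_le_of_le_one_left (h0 s)
    (Finset.prod_le_one (fun i _ => (h i).1) fun i _ => (h i).2)

theorem mem_Icc_of_hasProd {ι : Type*} {w : ι → ℝ} {t : ℝ} (h : ∀ i, w i ∈ Set.Icc (0 : ℝ) 1)
    (ht : HasProd w t) : t ∈ Set.Icc (0 : ℝ) 1 :=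
  isClosed_Icc.mem_of_tendsto ht (.of_forall fun _ =>
    ⟨Finset.prod_nonneg fun i _ => (h i).1,
      Finset.prod_le_one (fun i _ => (h i).1) fun i _ => (h i).2⟩)

theorem abs_sub_one_le_of_hasProd {ι : Type*} {w : ι → ℝ} {t : ℝ}
    (hs : Summable fun i => |w i - 1|) (ht : HasProd w t) :
    |t - 1| ≤ Real.exp (∑' i, |w i - 1|) - 1 := by
  have h1 : Tendsto (fun s : Finset ι => |∏ i ∈ s, w i - 1|) atTop (𝓝 |t - 1|) :=
    (Tendsto.sub_const ht 1).abs
  refine le_of_tendsto h1 (.of_forall fun s => ?_)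
  have h2 := s.norm_prod_one_add_sub_one_le (fun i => w i - 1)
  simp only [add_sub_cancel, Real.norm_eq_abs] at h2
  refine h2.trans (sub_le_sub_right (Real.exp_le_exp.2 ?_) 1)
  exact hs.sum_le_tsum s fun i _ => abs_nonneg _

/-- With `S i` the sum over the fiber, `|g i - 1| ≤ exp (S i) - 1 ≤ S i * exp (S i)`, and the last
exponential is bounded by `exp (∑ S)`. -/
theorem summable_abs_sub_one_of_hasProd_fiber {ι κ : Type*} {w : ι × κ → ℝ} {g : ι → ℝ}
    (hs : Summable fun p => |w p - 1|) (hg : ∀ i, HasProd (fun u => w (i, u)) (g i)) :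
    Summable fun i => |g i - 1| := by
  set S : ι → ℝ := fun i => ∑' u, |w (i, u) - 1|
  have hS : Summable S := hs.prod
  have hS0 : ∀ i, 0 ≤ S i := fun i => tsum_nonneg fun _ => abs_nonneg _
  refine (hS.mul_right (Real.exp (∑' i, S i))).of_nonneg_of_le (fun i => abs_nonneg _) fun i => ?_
  refine (abs_sub_one_le_of_hasProd (hs.prod_factor i) (hg i)).trans ?_
  have h1 : Real.exp (S i) - 1 ≤ S i * Real.exp (S i) := by
    have h2 := mul_le_mul_of_nonneg_right (Real.add_one_le_exp (-S i)) (Real.exp_pos (S i)).le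
    rw [← Real.exp_add, neg_add_cancel, Real.exp_zero] at h2
    linarith
  refine h1.trans (mul_le_mul_of_nonneg_left (Real.exp_le_exp.2 ?_) (hS0 i))
  exact hS.le_tsum i fun j _ => hS0 j

theorem measurable_of_hasProd {α ι : Type*} [MeasurableSpace α] [Countable ι] {w : ι → α → ℝ}
    (hw : ∀ i, Measurable (w i)) {T : α → ℝ} (hT : ∀ a, HasProd (fun i => w i a) (T a)) :
    Measurable T := by
  obtain ⟨F, hF⟩ := exists_seq_tendsto (atTop : Filter (Finset ι))
  refine measurable_of_tendsto_metrizable (f := fun n a => ∏ i ∈ F n, w i a)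
    (fun n => Finset.measurable_fun_prod _ fun i _ => hw i) ?_
  refine tendsto_pi_nhds.2 fun a => ?_
  have := hT a
  rw [HasProd, SummationFilter.unconditional_filter] at this
  exact this.comp hF

/-! ### Splitting the branching at the root -/

section

variable {d : ℕ}

/-- The offspring of the initial point, together with the branchings of its potential children. -/
def splitRoot (ω : Env d) : HawkesEnv d := (ω [], fun c v => ω (c :: v))

/-- The branching with given offspring of the initial point and branchings of its children. -/
def joinRoot (η : HawkesEnv d) : Env d
  | [] => η.1
  | c :: v => η.2 c v

theorem measurable_splitRoot : Measurable (splitRoot (d := d)) := by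
  unfold splitRoot; fun_prop

theorem measurable_joinRoot : Measurable (joinRoot (d := d)) := by
  refine measurable_pi_lambda _ fun u => ?_
  rcases u with _ | ⟨c, v⟩ <;> simp only [joinRoot] <;> fun_prop

theorem splitRoot_joinRoot (η : HawkesEnv d) : splitRoot (joinRoot η) = η := rfl

theorem injective_cons_pair {α : Type*} :
    Function.Injective fun p : α × List α => p.1 :: p.2 := by
  rintro ⟨a, b⟩ ⟨a', b'⟩ h
  simpa using h

theorem prod_list_finset {α M : Type*} [CommMonoid M] [DecidableEq (List α)] (S : Finset (List α))
    (F : List α → M) :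
    ∏ u ∈ S, F u = (if [] ∈ S then F [] else 1) *
      ∏ p ∈ S.preimage (fun p : α × List α => p.1 :: p.2) injective_cons_pair.injOn,
        F (p.1 :: p.2) := by
  classical
  rw [Finset.prod_preimage' (fun p : α × List α => p.1 :: p.2) S injective_cons_pair.injOn F]
  have h1 : ∀ u : List α, u ∈ Set.range (fun p : α × List α => p.1 :: p.2) ↔ u ≠ [] := by
    rintro (_ | ⟨a, u⟩) <;> simp
  simp_rw [h1]
  rw [← Finset.prod_filter_mul_prod_filter_not S (fun u => u = [])]
  congr 1
  rw [Finset.filter_eq']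
  split_ifs <;> simp

/-- It suffices to compare finite-dimensional boxes. A nonempty label is a child followed by a label
in its subtree, so a box splits into a condition on the root's sample and a box indexed by `Idx ×
Label`; currying identifies the latter law with independent branchings. -/
theorem map_joinRoot (γ : Measure (Space d)) [SFinite γ] :
    (hawkesLaw γ γ).map joinRoot = branchingLaw γ := by
  classical
  refine Measure.eq_infinitePi _ fun S t ht => ?_
  rw [Measure.map_apply measurable_joinRoot (.pi S.countable_toSet fun _ _ => ht _)]
  set S' := S.preimage (fun p : Idx × Label => p.1 :: p.2)
    injective_cons_pair.injOn with hS'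
  set A : Set (Sample d) := if [] ∈ S then t [] else Set.univ with hA
  have hpre : joinRoot ⁻¹' (Set.pi (S : Set Label) t) = A ×ˢ
      ((MeasurableEquiv.curry Idx Label (Sample d)).symm ⁻¹'
        (Set.pi (S' : Set (Idx × Label)) fun p => t (p.1 :: p.2))) := by
    ext η
    simp only [Set.mem_preimage, Set.mem_pi, Set.mem_prod, Finset.mem_coe]
    constructor
    · intro h
      refine ⟨?_, fun p hp => h (p.1 :: p.2) ?_⟩
      · rw [hA]; split_ifs with h0
        · exact h [] h0
        · trivial
      · rw [hS', Finset.mem_preimage] at hp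
        exact hp
    · rintro ⟨h1, h2⟩ u hu
      rcases u with _ | ⟨c, v⟩
      · rw [hA, if_pos hu] at h1; exact h1
      · exact h2 (c, v) (by rw [hS', Finset.mem_preimage]; exact hu)
  have hmap := Measure.infinitePi_map_curry_symm (fun (_ : Idx) (_ : Label) => poissonLaw γ)
  rw [hpre]
  unfold hawkesLaw
  rw [Measure.prod_prod, ← Measure.map_apply (MeasurableEquiv.measurable _)
    (.pi S'.countable_toSet fun _ _ => ht _)]
  unfold branchingLaw
  rw [hmap, Measure.infinitePi_pi _ (fun p _ => ht _), prod_list_finset S]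
  congr 1
  rw [hA]; split_ifs <;> simp

theorem measurePreserving_splitRoot (γ : Measure (Space d)) [SFinite γ] :
    MeasurePreserving splitRoot (branchingLaw γ) (hawkesLaw γ γ) := by
  refine ⟨measurable_splitRoot, ?_⟩
  rw [← map_joinRoot, Measure.map_map measurable_splitRoot measurable_joinRoot]
  exact Measure.map_id

/-- The descendants in a cluster are the points of the process formed by the children of the
initial point and their descendants. -/
def descendantsEquiv (ω : Env d) : hawkesPoints (splitRoot ω) ≃ descendants ω where
  toFun p := ⟨p.1.1 :: p.1.2, by simp, p.2⟩
  invFun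
    | ⟨[], h⟩ => absurd rfl h.1
    | ⟨c :: u, h⟩ => ⟨(c, u), h.2⟩
  left_inv _ := rfl
  right_inv
    | ⟨[], h⟩ => absurd rfl h.1
    | ⟨_ :: _, _⟩ => rfl

theorem clusterProd_eq_hawkesProd (f : Space d → ℝ) (z : Space d) (ω : Env d) :
    clusterProd f z ω = hawkesProd (fun y => f (z + y)) (splitRoot ω) :=
  ((descendantsEquiv ω).tprod_eq fun u : descendants ω => f (z + position ω u)).symm

theorem ae_hawkesLaw_iff (γ : Measure (Space d)) [SFinite γ] {p : HawkesEnv d → Prop} :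
    (∀ᵐ η ∂hawkesLaw γ γ, p η) ↔ ∀ᵐ ω ∂branchingLaw γ, p (splitRoot ω) := by
  constructor
  · exact fun h => (measurePreserving_splitRoot γ).quasiMeasurePreserving.ae h
  · intro h
    have hj : MeasurePreserving joinRoot (hawkesLaw γ γ) (branchingLaw γ) :=
      ⟨measurable_joinRoot, map_joinRoot γ⟩
    exact hj.quasiMeasurePreserving.ae h

theorem ClusterAdmissible.hawkesAdmissible {γ : Measure (Space d)} [SFinite γ] {f : Space d → ℝ}
    {z : Space d} (h : ClusterAdmissible γ f z) :
    HawkesAdmissible γ γ (fun y => f (z + y)) where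
  summable := by
    rw [ae_hawkesLaw_iff]
    filter_upwards [h.summable] with ω hω
    exact (descendantsEquiv ω).summable_iff.2 hω
  integrable := by
    have hj : MeasurePreserving joinRoot (hawkesLaw γ γ) (branchingLaw γ) :=
      ⟨measurable_joinRoot, map_joinRoot γ⟩
    refine (hj.integrable_comp_of_integrable h.integrable).congr (.of_forall fun η => ?_)
    exact clusterProd_eq_hawkesProd f z (joinRoot η)

theorem integral_clusterProd (γ : Measure (Space d)) [SFinite γ] (f : Space d → ℝ) (z : Space d) :
    ∫ ω, clusterProd f z ω ∂branchingLaw γ = hawkesPGFl γ γ (fun y => f (z + y)) := by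
  -- Changing variables along a measurable equivalence requires no measurability of `hawkesProd`.
  have he : MeasurableEmbedding (splitRoot (d := d)) :=
    MeasurableEquiv.measurableEmbedding
      { toFun := splitRoot
        invFun := joinRoot
        left_inv := fun ω => by ext u : 1; rcases u with _ | ⟨c, v⟩ <;> rfl
        right_inv := splitRoot_joinRoot
        measurable_toFun := measurable_splitRoot
        measurable_invFun := measurable_joinRoot }
  unfold hawkesPGFl
  rw [← (measurePreserving_splitRoot γ).integral_comp he]
  simp_rw [clusterProd_eq_hawkesProd]

theorem clusterPGFl_translate (γ : Measure (Space d)) [SFinite γ] (f : Space d → ℝ)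
    (z x : Space d) :
    clusterPGFl γ (fun y => f (z + y)) x = clusterPGFl γ f (z + x) := by
  simp only [clusterPGFl, clusterProd, add_assoc]

theorem clusterAdmissible_translate {γ : Measure (Space d)} [SFinite γ] {f : Space d → ℝ}
    {z x : Space d} (h : ClusterAdmissible γ (fun y => f (z + y)) x) :
    ClusterAdmissible γ f (z + x) where
  summable := by simpa only [add_assoc] using h.summable
  integrable := by
    have := h.integrable
    unfold clusterProd at this ⊢
    simpa only [add_assoc] using this

/-! ### The factors of the product over a cluster -/

theorem measurableSet_present (c : Idx) : MeasurableSet {s : Sample d | s.Present c} :=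
  measurableSet_lt measurable_const (by fun_prop)

theorem measurableSet_alive (u : Label) : MeasurableSet {ω : Env d | Alive ω u} := by
  induction u with
  | nil => simp [Alive]
  | cons c u ih =>
    have h1 : Measurable fun ω : Env d => ω [] := by fun_prop
    have h2 : Measurable fun (ω : Env d) (v : Label) => ω (c :: v) := by fun_prop
    exact (h1 (measurableSet_present c)).inter (h2 ih)

theorem measurable_position (u : Label) : Measurable fun ω : Env d => position ω u := by
  induction u with
  | nil => exact measurable_const
  | cons c u ih =>
    have h1 : Measurable fun ω : Env d => (ω []).loc c := by unfold Sample.loc; fun_prop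
    have h2 : Measurable fun (ω : Env d) (v : Label) => ω (c :: v) := by fun_prop
    exact h1.add (ih.comp h2)

open Classical in
/-- The factor of a potential individual in the product of `f` over the cluster started at `z`,
initial point included. -/
noncomputable def clusterFactor (f : Space d → ℝ) (q : Space d × Env d) (u : Label) : ℝ :=
  if Alive q.2 u then f (q.1 + position q.2 u) else 1

theorem measurable_clusterFactor {f : Space d → ℝ} (hf : Measurable f) (u : Label) :
    Measurable fun q => clusterFactor f q u := by
  refine Measurable.ite (measurable_snd (measurableSet_alive u)) ?_ measurable_const
  exact hf.comp (measurable_fst.add ((measurable_position u).comp measurable_snd))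

theorem clusterFactor_mem_Icc {f : Space d → ℝ} (h01 : ∀ x, f x ∈ Set.Icc (0 : ℝ) 1)
    (q : Space d × Env d) (u : Label) : clusterFactor f q u ∈ Set.Icc (0 : ℝ) 1 := by
  unfold clusterFactor
  split_ifs
  · exact h01 _
  · simp

theorem hasProd_clusterFactor {f : Space d → ℝ} {q : Space d × Env d}
    (h : Multipliable fun u : descendants q.2 => f (q.1 + position q.2 u)) :
    HasProd (clusterFactor f q) (f q.1 * clusterProd f q.1 q.2) := by
  classical
  have h1 := h.hasProd
  change HasProd ((fun u => f (q.1 + position q.2 u)) ∘ ((↑) : descendants q.2 → Label))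
    (clusterProd f q.1 q.2) at h1
  rw [hasProd_subtype_iff_mulIndicator] at h1
  convert (hasProd_ite_eq ([] : Label) (f q.1)).mul h1 using 1
  ext u
  rcases u with _ | ⟨c, u⟩
  · simp [clusterFactor, Alive, position, descendants]
  · by_cases hu : Alive q.2 (c :: u) <;> simp [clusterFactor, hu, descendants]

theorem summable_descendants_iff {f : Space d → ℝ} {q : Space d × Env d} :
    (Summable fun u => |clusterFactor f q u - 1|) ↔
      Summable fun u : descendants q.2 => |f (q.1 + position q.2 u) - 1| := by
  classical
  have h1 : (fun u : descendants q.2 => |f (q.1 + position q.2 u) - 1|) =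
      (fun u => |clusterFactor f q u - 1|) ∘ ((↑) : descendants q.2 → Label) := by
    ext u
    simp [clusterFactor, u.2.2]
  rw [h1]
  refine ⟨fun h => h.subtype _, fun h => ?_⟩
  rw [summable_subtype_iff_indicator] at h
  -- The two families differ only at the root, a single term.
  refine (summable_congr_cofinite ?_).1 h
  filter_upwards [(Set.finite_singleton ([] : Label)).compl_mem_cofinite] with u hu
  by_cases hd : u ∈ descendants q.2
  · simp [hd]
  · have : ¬ Alive q.2 u := fun ha => hd ⟨hu, ha⟩
    simp [hd, clusterFactor, this]

theorem measurableSet_summable_clusterFactor {f : Space d → ℝ} (hf : Measurable f) :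
    MeasurableSet {q : Space d × Env d | Summable fun u => |clusterFactor f q u - 1|} := by
  have h1 : {q : Space d × Env d | Summable fun u => |clusterFactor f q u - 1|} =
      {q | ∑' u, ENNReal.ofReal |clusterFactor f q u - 1| ≠ ∞} := by
    ext q
    refine ⟨fun h => h.tsum_ofReal_ne_top, fun h => ?_⟩
    simpa using ENNReal.summable_toReal h
  rw [h1]
  refine (measurableSet_eq_fun (Measurable.tsum fun u => ?_) measurable_const).compl
  exact ((measurable_clusterFactor hf u).sub_const 1).abs.ennreal_ofReal

theorem measurable_ite_clusterProd {f : Space d → ℝ} (hf : Measurable f)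
    {S : Set (Space d × Env d)} [DecidablePred (· ∈ S)] (hS : MeasurableSet S)
    (h : ∀ q ∈ S, HasProd (clusterFactor f q) (f q.1 * clusterProd f q.1 q.2)) :
    Measurable fun q => if q ∈ S then f q.1 * clusterProd f q.1 q.2 else 1 := by
  refine measurable_of_hasProd (w := fun u q => if q ∈ S then clusterFactor f q u else 1)
    (fun u => (measurable_clusterFactor hf u).ite hS measurable_const) fun q => ?_
  by_cases hq : q ∈ S
  · simpa only [hq, if_true] using h q hq
  · simpa only [hq, if_false] using hasProd_one

/-! ### The product over a Hawkes process as a product over its clusters -/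

open Classical in
/-- The factor of a potential individual in the product of `f` over the Hawkes process. -/
noncomputable def hawkesFactor (f : Space d → ℝ) (η : HawkesEnv d) (p : Idx × Label) : ℝ :=
  if η.1.Present p.1 then clusterFactor f (η.1.loc p.1, η.2 p.1) p.2 else 1

theorem hawkesFactor_eq_of_mem {f : Space d → ℝ} {η : HawkesEnv d} {p : Idx × Label}
    (hp : p ∈ hawkesPoints η) : hawkesFactor f η p = f (hawkesPosition η p) := by
  unfold hawkesFactor clusterFactor
  rw [if_pos hp.1, if_pos hp.2]
  rfl

theorem hawkesFactor_eq_of_notMem {f : Space d → ℝ} {η : HawkesEnv d} {p : Idx × Label}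
    (hp : p ∉ hawkesPoints η) : hawkesFactor f η p = 1 := by
  unfold hawkesFactor clusterFactor
  split_ifs with h1 h2
  · exact absurd ⟨h1, h2⟩ hp
  · rfl
  · rfl

theorem hasProd_hawkesFactor {f : Space d → ℝ} {η : HawkesEnv d}
    (h : Multipliable (hawkesFactor f η)) : HasProd (hawkesFactor f η) (hawkesProd f η) := by
  have h1 : hawkesProd f η = ∏' p, hawkesFactor f η p := by
    unfold hawkesProd
    rw [tprod_subtype (hawkesPoints η) fun p => f (hawkesPosition η p)]
    congr 1 with p
    by_cases hp : p ∈ hawkesPoints η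
    · rw [Set.mulIndicator_of_mem hp, hawkesFactor_eq_of_mem hp]
    · rw [Set.mulIndicator_of_notMem hp, hawkesFactor_eq_of_notMem hp]
  rw [h1]
  exact h.hasProd

theorem summable_hawkesFactor {f : Space d → ℝ} {η : HawkesEnv d}
    (h : Summable fun p : hawkesPoints η => |f (hawkesPosition η p) - 1|) :
    Summable fun p => |hawkesFactor f η p - 1| := by
  have h1 := (summable_subtype_iff_indicator (s := hawkesPoints η)
    (f := fun p => |f (hawkesPosition η p) - 1|)).1 h
  refine h1.congr fun p => ?_
  by_cases hp : p ∈ hawkesPoints η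
  · rw [Set.indicator_of_mem hp, hawkesFactor_eq_of_mem hp]
  · rw [Set.indicator_of_notMem hp, hawkesFactor_eq_of_notMem hp]; simp

theorem hasProd_hawkesFactor_fiber {f : Space d → ℝ} {h : Space d × Env d → ℝ} {η : HawkesEnv d}
    (hη : ∀ i, η.1.Present i →
      HasProd (clusterFactor f (η.1.loc i, η.2 i)) (h (η.1.loc i, η.2 i))) (i : Idx) :
    HasProd (fun u => hawkesFactor f η (i, u)) (markedFactor h η i) := by
  unfold hawkesFactor markedFactor
  by_cases hi : η.1.Present i
  · simpa only [hi, if_true] using hη i hi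
  · simpa only [hi, if_false] using hasProd_one

theorem hasProd_markedFactor {f : Space d → ℝ} {h : Space d × Env d → ℝ} {η : HawkesEnv d}
    (hm : Multipliable (hawkesFactor f η)) (hη : ∀ i, η.1.Present i →
      HasProd (clusterFactor f (η.1.loc i, η.2 i)) (h (η.1.loc i, η.2 i))) :
    HasProd (markedFactor h η) (hawkesProd f η) :=
  (hasProd_hawkesFactor hm).prod_fiberwise (hasProd_hawkesFactor_fiber hη)

/-! ### The generating functional of the Hawkes process -/

variable {ν γ : Measure (Space d)} [SFinite ν] [SFinite γ] {f : Space d → ℝ}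

theorem HawkesAdmissible.clusterPGFl (hf : Measurable f) (hadm : HawkesAdmissible ν γ f) :
    (∀ᵐ z ∂ν, f z ≠ 0 → ClusterAdmissible γ f z) ∧
      Integrable (fun z => clusterPGFl γ f z - 1) ν ∧
      hawkesPGFl ν γ f = Real.exp (∫ z, (HawkesCluster.clusterPGFl γ f z - 1) ∂ν) := by
  classical
  set S : Set (Space d × Env d) := {q | Summable fun u => |clusterFactor f q u - 1|} with hSdef
  have hS : MeasurableSet S := measurableSet_summable_clusterFactor hf
  have hSp : ∀ q ∈ S, HasProd (clusterFactor f q) (f q.1 * clusterProd f q.1 q.2) := fun q hq =>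
    hasProd_clusterFactor (multipliable_of_summable_abs_sub_one (summable_descendants_iff.1 hq))
  -- Off `S` the product need not converge; the value `1` there keeps `h` measurable, and almost
  -- surely no immigrant falls outside `S`.
  set h : Space d × Env d → ℝ := fun q => if q ∈ S then f q.1 * clusterProd f q.1 q.2 else 1
  have hh : Measurable h := measurable_ite_clusterProd hf hS hSp
  have hSh : ∀ q ∈ S, h q = f q.1 * clusterProd f q.1 q.2 := fun q hq => if_pos hq
  have hsum : ∀ᵐ η ∂markedLaw ν (branchingLaw γ), Summable fun p => |hawkesFactor f η p - 1| :=
    Eventually.mono hadm.summable fun η hη => summable_hawkesFactor hη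
  have hmem : ∀ᵐ η ∂markedLaw ν (branchingLaw γ),
      ∀ i, η.1.Present i → (η.1.loc i, η.2 i) ∈ S := by
    filter_upwards [hsum] with η hη i hi
    have := hη.prod_factor i
    simp only [hawkesFactor, hi, if_true] at this
    exact this
  have hfib : ∀ᵐ η ∂markedLaw ν (branchingLaw γ), ∀ i, η.1.Present i →
      HasProd (clusterFactor f (η.1.loc i, η.2 i)) (h (η.1.loc i, η.2 i)) := by
    filter_upwards [hmem] with η hη i hi
    rw [hSh _ (hη i hi)]
    exact hSp _ (hη i hi)
  have hT : ∀ᵐ η ∂markedLaw ν (branchingLaw γ),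
      Tendsto (fun n => partialProd h n η) atTop (𝓝 (hawkesProd f η)) := by
    filter_upwards [hsum, hfib] with η h1 h2
    exact tendsto_partialProd_of_hasProd
      (hasProd_markedFactor (multipliable_of_summable_abs_sub_one h1) h2)
  have hs : ∀ᵐ η ∂markedLaw ν (branchingLaw γ), Summable fun i => |markedFactor h η i - 1| := by
    filter_upwards [hsum, hfib] with η h1 h2
    exact summable_abs_sub_one_of_hasProd_fiber h1 (hasProd_hawkesFactor_fiber h2)
  have hi : Integrable (fun q => h q - 1) (ν.prod (branchingLaw γ)) :=
    integrable_sub_one_of_integrable ν (branchingLaw γ) hh hs hadm.integrable hT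
  have hae : ∀ᵐ z ∂ν, ∀ᵐ ω ∂branchingLaw γ, (z, ω) ∈ S :=
    Measure.ae_ae_of_ae_prod (ae_prod_of_ae_markedLaw ν (branchingLaw γ) hS hmem)
  have hhi : ∀ᵐ z ∂ν, Integrable (fun ω => h (z, ω)) (branchingLaw γ) := by
    filter_upwards [hi.prod_right_ae] with z hz
    exact (hz.add (integrable_const (1 : ℝ))).congr (.of_forall fun ω => by simp)
  have hG : ∀ᵐ z ∂ν, ∫ ω, (h (z, ω) - 1) ∂branchingLaw γ =
      HawkesCluster.clusterPGFl γ f z - 1 := by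
    filter_upwards [hae, hhi] with z hz hz2
    rw [integral_sub hz2 (integrable_const _), integral_const, probReal_univ, one_smul,
      HawkesCluster.clusterPGFl, ← integral_const_mul]
    congr 1
    exact integral_congr_ae (hz.mono fun ω hω => hSh _ hω)
  refine ⟨?_, hi.integral_prod_left.congr hG, ?_⟩
  -- Integrability is known for `f z * clusterProd f z`, so recovering it for `clusterProd f z`
  -- requires dividing by `f z ≠ 0`.
  · filter_upwards [hae, hhi] with z hz hz2 hz0
    refine ⟨hz.mono fun ω hω => summable_descendants_iff.1 hω, ?_⟩
    refine (hz2.const_mul (f z)⁻¹).congr (hz.mono fun ω hω => ?_)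
    simp only [hSh _ hω]
    field_simp
  · rw [← integral_congr_ae hG, ← integral_prod _ hi]
    exact (integral_of_integrable_sub_one ν (branchingLaw γ) hh hi hT).2

/-- Every product of factors in `[0, 1]` converges unconditionally, possibly to `0`, so no
exceptional set is needed. -/
theorem ofReal_hawkesPGFl (hf : Measurable f) (h01 : ∀ x, f x ∈ Set.Icc (0 : ℝ) 1) :
    ENNReal.ofReal (hawkesPGFl ν γ f) = EReal.exp
      (-((∫⁻ z, ENNReal.ofReal (1 - clusterPGFl γ f z) ∂ν : ℝ≥0∞) : EReal)) := by
  classical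
  have hSp : ∀ q : Space d × Env d,
      HasProd (clusterFactor f q) (f q.1 * clusterProd f q.1 q.2) := fun q =>
    hasProd_clusterFactor (multipliable_of_mem_Icc fun u => h01 _)
  set h : Space d × Env d → ℝ := fun q => f q.1 * clusterProd f q.1 q.2
  have hh : Measurable h := measurable_of_hasProd (measurable_clusterFactor hf) hSp
  have hh01 : ∀ q, h q ∈ Set.Icc (0 : ℝ) 1 := fun q =>
    mem_Icc_of_hasProd (clusterFactor_mem_Icc h01 q) (hSp q)
  have hm : ∀ η : HawkesEnv d, Multipliable (hawkesFactor f η) := fun η =>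
    multipliable_of_mem_Icc fun p => by
      unfold hawkesFactor
      split_ifs
      · exact clusterFactor_mem_Icc h01 _ _
      · simp
  have hmain := ofReal_integral_of_mem_Icc ν (branchingLaw γ) hh hh01 (T := hawkesProd f)
    (.of_forall fun η => tendsto_partialProd_of_hasProd
      (hasProd_markedFactor (hm η) fun i _ => hSp _))
  refine Eq.trans hmain ?_
  rw [lintegral_prod _ (by fun_prop)]
  congr 4 with z
  have hi : Integrable (fun ω => h (z, ω)) (branchingLaw γ) :=
    Integrable.of_bound (hh.comp measurable_prodMk_left).aestronglyMeasurable 1 (.of_forall fun ω => by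
      rw [Real.norm_eq_abs, abs_le]; constructor <;> linarith [(hh01 (z, ω)).1, (hh01 (z, ω)).2])
  rw [← ofReal_integral_eq_lintegral_ofReal (f := fun ω => 1 - h (z, ω))
    ((integrable_const _).sub hi)
    (.of_forall fun ω => sub_nonneg.2 (hh01 (z, ω)).2), integral_sub (integrable_const _) hi,
    integral_const, probReal_univ, one_smul, clusterPGFl, ← integral_const_mul]

end

end HawkesCluster

/-! ### The cluster and Hawkes identities. -/

theorem mainTheorem2 (d : ℕ)
    (γ ν : Measure (HawkesCluster.Space d)) [SigmaFinite γ] [SigmaFinite ν]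
    (f : HawkesCluster.Space d → ℝ) (hf : Measurable f) :
    -- real-valued, sufficiently integrable functions: cluster started from `z`
    (∀ z : HawkesCluster.Space d, HawkesCluster.ClusterAdmissible γ f z →
      (∀ᵐ x ∂γ, f (z + x) ≠ 0 → HawkesCluster.ClusterAdmissible γ f (z + x)) ∧
      Integrable (fun x => HawkesCluster.clusterPGFl γ f (z + x) - 1) γ ∧
      HawkesCluster.clusterPGFl γ f z =
        f z * Real.exp (∫ x, (HawkesCluster.clusterPGFl γ f (z + x) - 1) ∂γ)) ∧
    -- real-valued, sufficiently integrable functions: Hawkes process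
    (HawkesCluster.HawkesAdmissible ν γ f →
      (∀ᵐ z ∂ν, f z ≠ 0 → HawkesCluster.ClusterAdmissible γ f z) ∧
      Integrable (fun z => HawkesCluster.clusterPGFl γ f z - 1) ν ∧
      HawkesCluster.hawkesPGFl ν γ f =
        Real.exp (∫ z, (HawkesCluster.clusterPGFl γ f z - 1) ∂ν)) ∧
    -- functions with values in `[0, 1]`: no integrability needed, with `exp (-∞) = 0`
    ((∀ x, f x ∈ Set.Icc (0 : ℝ) 1) →
      (∀ z : HawkesCluster.Space d,
        ENNReal.ofReal (HawkesCluster.clusterPGFl γ f z) =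
          ENNReal.ofReal (f z) * EReal.exp
            (-((∫⁻ x, ENNReal.ofReal (1 - HawkesCluster.clusterPGFl γ f (z + x)) ∂γ : ℝ≥0∞) :
              EReal))) ∧
      ENNReal.ofReal (HawkesCluster.hawkesPGFl ν γ f) =
        EReal.exp
          (-((∫⁻ z, ENNReal.ofReal (1 - HawkesCluster.clusterPGFl γ f z) ∂ν : ℝ≥0∞) :
            EReal))) := by
  refine ⟨fun z hz => ?_, fun h => h.clusterPGFl hf, fun h01 => ⟨fun z => ?_,
    HawkesCluster.ofReal_hawkesPGFl hf h01⟩⟩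
  · obtain ⟨h1, h2, h3⟩ := hz.hawkesAdmissible.clusterPGFl (by fun_prop)
    simp_rw [HawkesCluster.clusterPGFl_translate] at h2 h3
    refine ⟨h1.mono fun x hx hx0 => HawkesCluster.clusterAdmissible_translate (hx hx0), h2, ?_⟩
    rw [← h3, HawkesCluster.clusterPGFl, HawkesCluster.integral_clusterProd]
  · have h := HawkesCluster.ofReal_hawkesPGFl (ν := γ) (γ := γ) (f := fun y => f (z + y))
      (by fun_prop) fun x => h01 _
    simp_rw [HawkesCluster.clusterPGFl_translate] at h
    rw [← h, HawkesCluster.clusterPGFl, HawkesCluster.integral_clusterProd,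
      ENNReal.ofReal_mul (h01 z).1]
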